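/- All C$^*$-algebras are assumed to be unital. For a C$^*$-algebra $A$, let $A^{**}$ denote its double dual, regarded as a C$^*$-algebra (the enveloping von Neumann algebra $\pi_u(A)''$ of $A$, where $\pi_u$ is the universal representation) in which $A$ is canonically embedded. A C$^*$-subalgebra $A$ of a C$^*$-algebra $B$ is called \emph{relatively weakly injective} in $B$ if there is a unital completely positive (u.c.p.) map $\phi : B \to A^{**}$ with $\phi(a) = a$ for all $a \in A$. For an ultrafilter $\omega$ on a set $I$, the ultrapower of $A$ is the C$^*$-algebra $$A^\omega = \ell^\infty(I, A)\big/\{(a_i)_{i\in I} : \lim_{i \to \omega} \|a_i\| = 0\},$$ and the diagonal embedding $A \to A^\omega$ sends $a$ to the class of the constant family $(a)_{i \in I}$. \textbf{Proposition.} Let $A$ be a C$^*$-algebra and let $\omega$ be a nonprincipal ultrafilter on some (possibly uncountable) index set. (1) Suppose that $A$ is a C$^*$-subalgebra of a C$^*$-algebra $B$ and that there is a u.c.p. map $B \to A^\omega$ whose restriction to $A$ is the diagonal embedding of $A$. Then $A$ is relatively weakly injective in $B$. (2) $A$, regarded as a subalgebra of $A^\omega$ through the diagonal embedding, is relatively weakly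 injective in $A^\omega$. -/

import Mathlib

open Filter Topology
open scoped ENNReal ComplexOrder InnerProductSpace CStarAlgebra

/-! ### Ultrapowers of C⋆-algebras -/

section Ultrapower

/-- The bounded families `(xᵢ)` in `A` with `lim_ω ‖xᵢ‖ = 0`. -/
def ultraNull {ι : Type*} (A : Type*) [CStarAlgebra A] (ω : Ultrafilter ι) :
    Submodule ℂ (lp (fun _ : ι => A) ∞) where
  carrier := {x | Tendsto (fun i => ‖x i‖) ω (𝓝 0)}
  zero_mem' := by simp
  add_mem' {x y} hx hy := by
    refine squeeze_zero (fun _ => norm_nonneg _) (fun i => ?_)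
      (by simpa using Tendsto.add hx hy)
    simpa using norm_add_le (x i) (y i)
  smul_mem' c x hx := by
    have := Tendsto.const_mul ‖c‖ hx
    simpa [norm_smul] using this

/-- The C⋆-algebra ultrapower `A^ω = ℓ^∞(ι, A) / {x | lim_ω ‖xᵢ‖ = 0}`; the norm is the
quotient norm, which equals `lim_ω ‖xᵢ‖`. -/
def Ultrapower {ι : Type*} (A : Type*) [CStarAlgebra A] (ω : Ultrafilter ι) : Type _ :=
  lp (fun _ : ι => A) ∞ ⧸ ultraNull A ω

namespace Ultrapower

variable {ι : Type*} {A : Type*} [CStarAlgebra A] {ω : Ultrafilter ι}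

theorem isClosed_ultraNull : IsClosed (ultraNull A ω : Set (lp (fun _ : ι => A) ∞)) := by
  refine isClosed_of_closure_subset fun x hx => ?_
  change Tendsto (fun i => ‖x i‖) ω (𝓝 0)
  rw [Metric.tendsto_nhds]
  intro ε hε
  obtain ⟨y, hy, hxy⟩ := Metric.mem_closure_iff.1 hx (ε / 2) (by positivity)
  have hy' : Tendsto (fun i => ‖y i‖) ω (𝓝 0) := hy
  filter_upwards [hy'.eventually_lt_const (show (0 : ℝ) < ε / 2 by positivity)] with i hi
  have h1 : ‖(x - y) i‖ ≤ ‖x - y‖ := lp.norm_apply_le_norm ENNReal.top_ne_zero _ i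
  have h2 : ‖x i‖ ≤ ‖(x - y) i‖ + ‖y i‖ := by
    simpa using norm_add_le ((x - y) i) (y i)
  rw [dist_eq_norm] at hxy
  simpa using (by linarith : ‖x i‖ < ε)

noncomputable instance : NormedAddCommGroup (Ultrapower A ω) :=
  haveI : IsClosed (ultraNull A ω : Set (lp (fun _ : ι => A) ∞)) := isClosed_ultraNull
  inferInstanceAs (NormedAddCommGroup (lp (fun _ : ι => A) ∞ ⧸ ultraNull A ω))

noncomputable instance : NormedSpace ℂ (Ultrapower A ω) :=
  inferInstanceAs (NormedSpace ℂ (lp (fun _ : ι => A) ∞ ⧸ ultraNull A ω))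

instance : CompleteSpace (Ultrapower A ω) :=
  inferInstanceAs (CompleteSpace (lp (fun _ : ι => A) ∞ ⧸ ultraNull A ω))

/-- The class in `A^ω` of a bounded family. -/
noncomputable def mk (A : Type*) [CStarAlgebra A] (ω : Ultrafilter ι) :
    lp (fun _ : ι => A) ∞ →ₗ[ℂ] Ultrapower A ω :=
  (ultraNull A ω).mkQ

theorem mk_surjective : Function.Surjective (mk A ω) :=
  Submodule.mkQ_surjective _

theorem mk_eq_mk {x y : lp (fun _ : ι => A) ∞} :
    mk A ω x = mk A ω y ↔ Tendsto (fun i => ‖x i - y i‖) ω (𝓝 0) :=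
  Submodule.Quotient.eq (ultraNull A ω)

theorem tendsto_norm_mk (x : lp (fun _ : ι => A) ∞) :
    Tendsto (fun i => ‖x i‖) ω (𝓝 ‖mk A ω x‖) := by
  classical
  rw [Metric.tendsto_nhds]
  intro ε hε
  have hup : ∀ᶠ i in (ω : Filter ι), ‖x i‖ < ‖mk A ω x‖ + ε := by
    obtain ⟨m, hm, hmlt⟩ := QuotientAddGroup.exists_norm_mk_lt
      (S := (ultraNull A ω).toAddSubgroup) (mk A ω x) (half_pos hε)
    have hmx : mk A ω x = mk A ω m := hm.symm
    filter_upwards [(mk_eq_mk.1 hmx).eventually_lt_const (half_pos hε)] with i hi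
    have h1 : ‖m i‖ ≤ ‖m‖ := lp.norm_apply_le_norm ENNReal.top_ne_zero _ i
    have h2 : ‖x i‖ ≤ ‖x i - m i‖ + ‖m i‖ := by
      simpa using norm_add_le (x i - m i) (m i)
    have h3 : ‖m‖ < ‖mk A ω x‖ + ε / 2 := hmlt
    linarith
  have hlo : ∀ᶠ i in (ω : Filter ι), ‖mk A ω x‖ - ε < ‖x i‖ := by
    by_contra hcon
    rw [← Ultrafilter.eventually_not] at hcon
    simp only [not_lt] at hcon
    obtain ⟨i₀, hi₀⟩ := hcon.exists
    have hC : 0 ≤ ‖mk A ω x‖ - ε := (norm_nonneg _).trans hi₀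
    let y : lp (fun _ : ι => A) ∞ :=
      ⟨fun i => if ‖x i‖ ≤ ‖mk A ω x‖ - ε then x i else 0,
        memℓp_infty ⟨‖mk A ω x‖ - ε, by
          rintro _ ⟨i, rfl⟩
          by_cases h : ‖x i‖ ≤ ‖mk A ω x‖ - ε <;> simp only [h, if_true, if_false, norm_zero, hC]⟩⟩
    have hy : ‖y‖ ≤ ‖mk A ω x‖ - ε := by
      refine lp.norm_le_of_forall_le hC fun i => ?_
      change ‖(if ‖x i‖ ≤ ‖mk A ω x‖ - ε then x i else 0)‖ ≤ _
      split_ifs with h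
      · exact h
      · simpa using hC
    have hxy : mk A ω x = mk A ω y := by
      refine mk_eq_mk.2 (tendsto_const_nhds.congr' ?_)
      filter_upwards [hcon] with i hi
      change 0 = ‖x i - (if ‖x i‖ ≤ ‖mk A ω x‖ - ε then x i else 0)‖
      simp [hi]
    have : ‖mk A ω y‖ ≤ ‖y‖ := Submodule.Quotient.norm_mk_le (ultraNull A ω) y
    rw [← hxy] at this
    linarith
  filter_upwards [hup, hlo] with i h1 h2
  rw [Real.dist_eq, abs_lt]
  constructor <;> linarith

theorem bdd (x : lp (fun _ : ι => A) ∞) (i : ι) : ‖x i‖ ≤ ‖x‖ :=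
  lp.norm_apply_le_norm ENNReal.top_ne_zero x i

theorem mk_mul_congr {x x' y y' : lp (fun _ : ι => A) ∞}
    (hx : mk A ω x = mk A ω x') (hy : mk A ω y = mk A ω y') : mk A ω (x * y) = mk A ω (x' * y') := by
  rw [mk_eq_mk] at hx hy ⊢
  refine squeeze_zero (g := fun i => ‖x i - x' i‖ * ‖y‖ + ‖x'‖ * ‖y i - y' i‖)
    (fun _ => norm_nonneg _) (fun i => ?_)
    (by simpa using (hx.mul_const ‖y‖).add (hy.const_mul ‖x'‖))
  calc ‖x i * y i - x' i * y' i‖ = ‖(x i - x' i) * y i + x' i * (y i - y' i)‖ := by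
        congr 1; noncomm_ring
    _ ≤ ‖(x i - x' i) * y i‖ + ‖x' i * (y i - y' i)‖ := norm_add_le _ _
    _ ≤ ‖x i - x' i‖ * ‖y i‖ + ‖x' i‖ * ‖y i - y' i‖ :=
        add_le_add (norm_mul_le _ _) (norm_mul_le _ _)
    _ ≤ _ := by gcongr <;> exact bdd _ i

theorem mk_star_congr {x x' : lp (fun _ : ι => A) ∞}
    (hx : mk A ω x = mk A ω x') : mk A ω (star x) = mk A ω (star x') := by
  rw [mk_eq_mk] at hx ⊢
  refine hx.congr fun i => ?_
  rw [lp.star_apply, lp.star_apply, ← star_sub, norm_star]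

/-- The constant family with value `a`. -/
def const (ι : Type*) (a : A) : lp (fun _ : ι => A) ∞ :=
  ⟨fun _ => a, memℓp_infty ⟨‖a‖, by rintro _ ⟨i, rfl⟩; exact le_rfl⟩⟩

theorem const_apply (a : A) (i : ι) : const ι a i = a := rfl

noncomputable instance : One (Ultrapower A ω) := ⟨mk A ω (const ι 1)⟩

/-- Multiplication in `A^ω` is computed on representatives. -/
noncomputable instance : Mul (Ultrapower A ω) :=
  ⟨Quotient.map₂ (fun x y => x * y) fun _ _ hx _ _ hy =>
    Quotient.exact (mk_mul_congr (Quotient.sound hx) (Quotient.sound hy))⟩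

/-- The involution of `A^ω` is computed on representatives. -/
noncomputable instance : Star (Ultrapower A ω) :=
  ⟨Quotient.map (fun x => star x) fun _ _ hx => Quotient.exact (mk_star_congr (Quotient.sound hx))⟩

theorem mk_mul (x y : lp (fun _ : ι => A) ∞) : mk A ω (x * y) = mk A ω x * mk A ω y := rfl

theorem mk_star (x : lp (fun _ : ι => A) ∞) : mk A ω (star x) = star (mk A ω x) := rfl

theorem one_def : (1 : Ultrapower A ω) = mk A ω (const ι 1) := rfl

noncomputable instance : NormedRing (Ultrapower A ω) :=
  { (inferInstance : NormedAddCommGroup (Ultrapower A ω)) with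
    mul := (· * ·)
    one := 1
    mul_assoc := fun a b c => by
      obtain ⟨x, rfl⟩ := mk_surjective a
      obtain ⟨y, rfl⟩ := mk_surjective b
      obtain ⟨z, rfl⟩ := mk_surjective c
      simp only [← mk_mul, mul_assoc]
    left_distrib := fun a b c => by
      obtain ⟨x, rfl⟩ := mk_surjective a
      obtain ⟨y, rfl⟩ := mk_surjective b
      obtain ⟨z, rfl⟩ := mk_surjective c
      simp only [← mk_mul, ← map_add, mul_add]
    right_distrib := fun a b c => by
      obtain ⟨x, rfl⟩ := mk_surjective a
      obtain ⟨y, rfl⟩ := mk_surjective b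
      obtain ⟨z, rfl⟩ := mk_surjective c
      simp only [← mk_mul, ← map_add, add_mul]
    zero_mul := fun a => by
      obtain ⟨x, rfl⟩ := mk_surjective a
      rw [← map_zero (mk A ω), ← mk_mul, zero_mul]
    mul_zero := fun a => by
      obtain ⟨x, rfl⟩ := mk_surjective a
      rw [← map_zero (mk A ω), ← mk_mul, mul_zero]
    one_mul := fun a => by
      obtain ⟨x, rfl⟩ := mk_surjective a
      rw [one_def, ← mk_mul]
      congr 1
      ext i
      simp [const_apply]
    mul_one := fun a => by
      obtain ⟨x, rfl⟩ := mk_surjective a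
      rw [one_def, ← mk_mul]
      congr 1
      ext i
      simp [const_apply]
    norm_mul_le := fun a b => by
      obtain ⟨x, rfl⟩ := mk_surjective a
      obtain ⟨y, rfl⟩ := mk_surjective b
      rw [← mk_mul]
      exact le_of_tendsto_of_tendsto' (tendsto_norm_mk (x * y))
        ((tendsto_norm_mk x).mul (tendsto_norm_mk y)) fun i => norm_mul_le (x i) (y i) }

noncomputable instance : NormedAlgebra ℂ (Ultrapower A ω) :=
  { Algebra.ofModule
      (fun r a b => by
        obtain ⟨x, rfl⟩ := mk_surjective a
        obtain ⟨y, rfl⟩ := mk_surjective b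
        rw [← mk_mul, ← map_smul, ← map_smul, ← mk_mul, smul_mul_assoc])
      (fun r a b => by
        obtain ⟨x, rfl⟩ := mk_surjective a
        obtain ⟨y, rfl⟩ := mk_surjective b
        rw [← mk_mul, ← map_smul, ← map_smul, ← mk_mul, mul_smul_comm]) with
    norm_smul_le := fun r a => norm_smul_le r a }

noncomputable instance : StarRing (Ultrapower A ω) where
  star_involutive a := by
    obtain ⟨x, rfl⟩ := mk_surjective a
    rw [← mk_star, ← mk_star, star_star]
  star_mul a b := by
    obtain ⟨x, rfl⟩ := mk_surjective a
    obtain ⟨y, rfl⟩ := mk_surjective b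
    rw [← mk_star, ← mk_star, ← mk_mul, ← mk_mul, ← mk_star, star_mul]
  star_add a b := by
    obtain ⟨x, rfl⟩ := mk_surjective a
    obtain ⟨y, rfl⟩ := mk_surjective b
    rw [← mk_star, ← mk_star, ← map_add, ← map_add, ← mk_star, star_add]

noncomputable instance : CStarAlgebra (Ultrapower A ω) where
  norm_mul_self_le a := by
    obtain ⟨x, rfl⟩ := mk_surjective a
    rw [← mk_star, ← mk_mul]
    exact le_of_tendsto_of_tendsto' ((tendsto_norm_mk x).mul (tendsto_norm_mk x))
      (tendsto_norm_mk (star x * x)) fun i => CStarRing.norm_star_mul_self (x := x i).symm.le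
  star_smul r a := by
    obtain ⟨x, rfl⟩ := mk_surjective a
    rw [← map_smul, ← mk_star, ← mk_star, ← map_smul, star_smul]

/-- The order of the C⋆-algebra `A^ω`. -/
noncomputable instance : PartialOrder (Ultrapower A ω) := CStarAlgebra.spectralOrder _

instance : StarOrderedRing (Ultrapower A ω) := CStarAlgebra.spectralOrderedRing _

/-- The diagonal embedding `A → A^ω`, `a ↦ [(a)ᵢ]`. -/
noncomputable def diagonal (A : Type*) [CStarAlgebra A] (ω : Ultrafilter ι) :
    A →⋆ₐ[ℂ] Ultrapower A ω where
  toFun a := mk A ω (const ι a)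
  map_one' := rfl
  map_mul' _ _ := rfl
  map_zero' := rfl
  map_add' _ _ := rfl
  commutes' r := by
    rw [Algebra.algebraMap_eq_smul_one, Algebra.algebraMap_eq_smul_one, one_def, ← map_smul]
    rfl
  map_star' _ := rfl

end Ultrapower

end Ultrapower

/-! ### The double dual `A**`, as the enveloping von Neumann algebra -/

section DoubleDual

variable (A : Type*) [CStarAlgebra A] [PartialOrder A] [StarOrderedRing A]

/-- The states of `A`. -/
def StateOf : Type _ := {f : A →ₚ[ℂ] ℂ // f 1 = 1}

/-- The Hilbert space of the universal representation: the `ℓ²`-direct sum of the GNS spaces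
of all states of `A`. -/
abbrev UniversalHilbert : Type _ := lp (fun f : StateOf A => f.1.GNS) 2

variable {A}

theorem gns_apply_norm_le (a : A) (x : UniversalHilbert A) (f : StateOf A) :
    ‖f.1.gnsStarAlgHom a (x f)‖ ≤ ‖((‖a‖ : ℂ) • x) f‖ := by
  rw [lp.coeFn_smul, Pi.smul_apply, norm_smul, Complex.norm_real, norm_norm]
  exact (ContinuousLinearMap.le_opNorm _ _).trans <|
    mul_le_mul_of_nonneg_right (NonUnitalStarAlgHom.norm_apply_le _ a) (norm_nonneg _)

/-- The operator `⊕_f π_f(a)`. -/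
noncomputable def universalOp (a : A) : UniversalHilbert A →L[ℂ] UniversalHilbert A :=
  LinearMap.mkContinuous
    { toFun := fun x => ⟨fun f => f.1.gnsStarAlgHom a (x f),
        (lp.memℓp ((‖a‖ : ℂ) • x)).mono' (gns_apply_norm_le a x)⟩
      map_add' := fun x y => by ext f; exact map_add (f.1.gnsStarAlgHom a) (x f) (y f)
      map_smul' := fun c x => by ext f; exact map_smul (f.1.gnsStarAlgHom a) c (x f) }
    ‖a‖ fun x => by
      refine (lp.norm_mono two_ne_zero (gns_apply_norm_le a x)).trans ?_
      rw [norm_smul, Complex.norm_real, norm_norm]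

theorem universalOp_apply (a : A) (x : UniversalHilbert A) (f : StateOf A) :
    universalOp a x f = f.1.gnsStarAlgHom a (x f) := rfl

variable (A) in
/-- The universal representation `π_u = ⊕_f π_f` of `A`. -/
noncomputable def universalRep : A →⋆ₐ[ℂ] (UniversalHilbert A →L[ℂ] UniversalHilbert A) where
  toFun := universalOp
  map_one' := by ext x f; rw [universalOp_apply, map_one]; rfl
  map_mul' a b := by ext x f; rw [universalOp_apply, map_mul]; rfl
  map_zero' := by ext x f; rw [universalOp_apply, map_zero]; rfl
  map_add' a b := by ext x f; rw [universalOp_apply, map_add]; rfl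
  commutes' r := by
    ext x f
    rw [universalOp_apply, AlgHomClass.commutes, Algebra.algebraMap_eq_smul_one,
      Algebra.algebraMap_eq_smul_one]
    rfl
  map_star' a := by
    rw [ContinuousLinearMap.star_eq_adjoint, ContinuousLinearMap.eq_adjoint_iff]
    intro x y
    rw [lp.inner_eq_tsum, lp.inner_eq_tsum]
    refine tsum_congr fun f => ?_
    rw [universalOp_apply, universalOp_apply, map_star, ContinuousLinearMap.star_eq_adjoint,
      ContinuousLinearMap.adjoint_inner_left]

variable (A) in
/-- The enveloping von Neumann algebra `π_u(A)''` of `A`: the double commutant of the image of the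
universal representation. -/
noncomputable def envelopingVonNeumannAlgebra : VonNeumannAlgebra (UniversalHilbert A) where
  toStarSubalgebra := StarSubalgebra.centralizer ℂ
    (StarSubalgebra.centralizer ℂ (Set.range (universalRep A)) :
      Set (UniversalHilbert A →L[ℂ] UniversalHilbert A))
  centralizer_centralizer' := by
    change Set.centralizer (Set.centralizer (Set.centralizer _)) = Set.centralizer _
    exact Set.centralizer_centralizer_centralizer _

variable (A) in
/-- The double dual `A**` of `A` as a (unital) C⋆-algebra, i.e. the enveloping von Neumann algebra
`π_u(A)''`, which is the standard realisation of the Banach space bidual of `A` as a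
von Neumann algebra (Sherman-Takeda). -/
abbrev DoubleDual : Type _ := (envelopingVonNeumannAlgebra A).toStarSubalgebra

theorem isClosed_vonNeumannAlgebra {H : Type*} [NormedAddCommGroup H] [InnerProductSpace ℂ H]
    [CompleteSpace H] (S : VonNeumannAlgebra H) :
    IsClosed (S.toStarSubalgebra : Set (H →L[ℂ] H)) := by
  rw [VonNeumannAlgebra.coe_toStarSubalgebra, ← S.centralizer_centralizer]
  exact Set.isClosed_centralizer _

namespace DoubleDual

instance : IsClosed ((envelopingVonNeumannAlgebra A).toStarSubalgebra :
    Set (UniversalHilbert A →L[ℂ] UniversalHilbert A)) :=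
  isClosed_vonNeumannAlgebra _

/-- The order of the C⋆-algebra `A**`. -/
noncomputable instance : PartialOrder (DoubleDual A) := CStarAlgebra.spectralOrder _

instance : StarOrderedRing (DoubleDual A) := CStarAlgebra.spectralOrderedRing _

theorem universalRep_mem (a : A) :
    universalRep A a ∈ (envelopingVonNeumannAlgebra A).toStarSubalgebra :=
  StarAlgebra.adjoin_le_centralizer_centralizer ℂ _
    (StarAlgebra.subset_adjoin ℂ _ ⟨a, rfl⟩)

variable (A) in
/-- The canonical embedding of `A` in its double dual. -/
noncomputable def inclusion : A →⋆ₐ[ℂ] DoubleDual A :=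
  (universalRep A).codRestrict _ universalRep_mem

end DoubleDual

end DoubleDual

/-! ### Relative weak injectivity -/

section RelativelyWeaklyInjective

variable {A B C : Type*} [CStarAlgebra A] [PartialOrder A] [StarOrderedRing A]
  [CStarAlgebra B] [PartialOrder B] [StarOrderedRing B]
  [CStarAlgebra C] [PartialOrder C] [StarOrderedRing C]

/-- A completely positive map is u.c.p. if it is in addition unital. -/
def IsUCP (φ : B →CP C) : Prop := φ 1 = 1

/-- `A`, regarded as a C⋆-subalgebra of `B` through the injective ⋆-homomorphism `j`, is relatively
weakly injective in `B`: there is a weak conditional expectation, that is, a u.c.p. map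
`φ : B → A**` which is the identity on `A`. -/
def RelativelyWeaklyInjective (j : A →⋆ₙₐ[ℂ] B) : Prop :=
  ∃ φ : B →CP DoubleDual A, IsUCP φ ∧ ∀ a : A, φ (j a) = DoubleDual.inclusion A a

end RelativelyWeaklyInjective

/-! There is a u.c.p. map `A^ω → A**` that is the identity on the diagonal copy of `A`: send the
class of `(aᵢ)` to the weak operator limit of `π_u(aᵢ)` along `ω`. The limit exists because the
family is bounded (`exists_weakLimit_ultrafilter`). It lies in `π_u(A)''` and does not depend on the
representative (`Ultrapower.exists_weakLimit`). This map proves (2), and its composite with `B →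
A^ω` proves (1).

The work is in complete positivity. For a positive matrix `N* N` over `A^ω`, the quadratic form of
the limit matrix is a limit of sums of squared norms, hence nonnegative
(`sum_inner_weakLimit_nonneg`). A self-adjoint matrix with nonnegative quadratic form is positive
(`CStarMatrix.nonneg_of_forall_sum_nonneg`), as compressing it by its negative part shows. -/

/-! ### Weak operator limits along an ultrafilter. -/

theorem exists_tendsto_ultrafilter_of_norm_le {ι : Type*} (ω : Ultrafilter ι) {u : ι → ℂ} {C : ℝ}
    (hu : ∀ i, ‖u i‖ ≤ C) : ∃ z, Tendsto u ω (𝓝 z) := by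
  obtain ⟨z, -, hz⟩ := (isCompact_closedBall (0 : ℂ) C).ultrafilter_le_nhds (ω.map u)
    (by
      rw [le_principal_iff]
      exact Filter.mem_map.2 (Filter.univ_mem' fun i => by simpa using hu i))
  exact ⟨z, hz⟩

/-- A bounded family of operators converges along an ultrafilter in the weak operator topology. -/
theorem exists_weakLimit_ultrafilter {ι H : Type*} [NormedAddCommGroup H] [InnerProductSpace ℂ H]
    [CompleteSpace H] (ω : Ultrafilter ι) {T : ι → H →L[ℂ] H} {C : ℝ} (hT : ∀ i, ‖T i‖ ≤ C) :
    ∃ S : H →L[ℂ] H, ∀ x y, Tendsto (fun i => ⟪T i x, y⟫_ℂ) ω (𝓝 ⟪S x, y⟫_ℂ) := by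
  have hbd (x y : H) (i : ι) : ‖⟪T i x, y⟫_ℂ‖ ≤ C * ‖x‖ * ‖y‖ :=
    (norm_inner_le_norm _ _).trans <| mul_le_mul_of_nonneg_right
      (((T i).le_opNorm x).trans (mul_le_mul_of_nonneg_right (hT i) (norm_nonneg _)))
      (norm_nonneg _)
  choose L hL using fun x y => exists_tendsto_ultrafilter_of_norm_le ω (hbd x y)
  -- Uniqueness of limits makes `L` sesquilinear, and it inherits the bound `C`; Riesz
  -- representation then gives the operator.
  let B : H →ₗ⋆[ℂ] H →ₗ[ℂ] ℂ := LinearMap.mk₂'ₛₗ (starRingEnd ℂ) (RingHom.id ℂ) L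
    (fun x x' y => tendsto_nhds_unique (hL _ _)
      (((hL x y).add (hL x' y)).congr fun i => by simp))
    (fun c x y => tendsto_nhds_unique (hL _ _)
      (((hL x y).const_mul (starRingEnd ℂ c)).congr fun i => by simp [mul_comm]))
    (fun x y y' => tendsto_nhds_unique (hL _ _)
      (((hL x y).add (hL x y')).congr fun i => by simp))
    (fun c x y => tendsto_nhds_unique (hL _ _)
      (((hL x y).const_mul c).congr fun i => by simp))
  refine ⟨InnerProductSpace.continuousLinearMapOfBilin (B.mkContinuous₂ C fun x y =>
    le_of_tendsto (hL x y).norm (Eventually.of_forall (hbd x y))), fun x y => ?_⟩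
  rw [InnerProductSpace.continuousLinearMapOfBilin_apply]
  exact hL x y

/-! ### Criteria for positivity in C⋆-algebras and in matrices over them. -/

theorem inner_self_nonneg_complex {H : Type*} [NormedAddCommGroup H] [InnerProductSpace ℂ H]
    (x : H) : 0 ≤ ⟪x, x⟫_ℂ := by
  rw [inner_self_eq_norm_sq_to_K]
  change (0 : ℂ) ≤ (‖x‖ : ℂ) ^ 2
  exact_mod_cast sq_nonneg ‖x‖

theorem ContinuousLinearMap.nonneg_of_forall_inner_nonneg {H : Type*} [NormedAddCommGroup H]
    [InnerProductSpace ℂ H] [CompleteSpace H] {T : H →L[ℂ] H} (h : ∀ x, 0 ≤ ⟪T x, x⟫_ℂ) :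
    0 ≤ T := by
  rw [ContinuousLinearMap.nonneg_iff_isPositive, ContinuousLinearMap.isPositive_iff_complex]
  intro x
  obtain ⟨h1, h2⟩ := Complex.nonneg_iff.1 (h x)
  exact ⟨Complex.ext (by simp) (by simp [← h2]), h1⟩

theorem inner_sum_star_mul_mul_apply {H n : Type*} [NormedAddCommGroup H] [InnerProductSpace ℂ H]
    [CompleteSpace H] [Fintype n] (T : n → n → H →L[ℂ] H) (V : n → H →L[ℂ] H) (x : H) :
    ⟪(∑ i, ∑ j, star (V i) * T i j * V j) x, x⟫_ℂ = ∑ i, ∑ j, ⟪T i j (V j x), V i x⟫_ℂ := by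
  simp only [sum_apply, sum_inner, mul_apply_eq_comp, ContinuousLinearMap.star_eq_adjoint,
    ContinuousLinearMap.adjoint_inner_left]

theorem CStarAlgebra.exists_eq_star_mul_self_of_nonneg {E : Type*} [CStarAlgebra E]
    [PartialOrder E] [StarOrderedRing E] {x : E} (hx : 0 ≤ x) : ∃ y : E, x = star y * y :=
  CStarAlgebra.nonneg_iff_eq_star_mul_self.1 hx

theorem CStarAlgebra.eq_zero_of_mul_self_mul_self_eq_zero {E : Type*} [CStarAlgebra E] {x : E}
    (hx : IsSelfAdjoint x) (h : x * x * x = 0) : x = 0 := by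
  have h1 : star (x * x) * (x * x) = 0 := by
    rw [star_mul, hx.star_eq, ← mul_assoc, h, zero_mul]
  have h2 : star x * x = 0 := by
    rw [hx.star_eq]; exact CStarRing.star_mul_self_eq_zero_iff _ |>.1 h1
  exact CStarRing.star_mul_self_eq_zero_iff _ |>.1 h2

/-- A self-adjoint element compresses to the opposite of a positive element by its negative
part. -/
theorem CStarAlgebra.exists_mul_self_mul_eq_neg {E : Type*} [CStarAlgebra E] [PartialOrder E]
    [StarOrderedRing E] {x : E} (hx : IsSelfAdjoint x) :
    ∃ p : E, IsSelfAdjoint p ∧ 0 ≤ p * p * p ∧ p * x * p = -(p * p * p) ∧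
      (p * p * p = 0 → 0 ≤ x) := by
  have hp : 0 ≤ x⁻ := CFC.negPart_nonneg x
  refine ⟨x⁻, hp.isSelfAdjoint, ?_, ?_, fun h => ?_⟩
  · have h := star_left_conjugate_nonneg hp x⁻
    rwa [hp.isSelfAdjoint.star_eq] at h
  -- The first occurrence of `x` is inside `x⁻`; the second is the middle factor.
  · nth_rw 2 [← CFC.posPart_sub_negPart x hx]
    rw [mul_sub, CFC.negPart_mul_posPart, zero_sub, neg_mul]
  · exact (CFC.negPart_eq_zero_iff x hx).1
      (CStarAlgebra.eq_zero_of_mul_self_mul_self_eq_zero hp.isSelfAdjoint h)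

/-- With `p = x⁻`, the element `f (p * p * p)` is both nonnegative and nonpositive, so injectivity
kills `p * p * p`. This carries positivity from operators on the universal Hilbert space back to the
intrinsic order of `A**`. -/
theorem CStarAlgebra.nonneg_of_map_nonneg {E F : Type*} [CStarAlgebra E] [PartialOrder E]
    [StarOrderedRing E] [CStarAlgebra F] [PartialOrder F] [StarOrderedRing F] (f : E →⋆ₐ[ℂ] F)
    (hf : Function.Injective f) {x : E} (hx : 0 ≤ f x) : 0 ≤ x := by
  have hsa : IsSelfAdjoint x := hf ((map_star f x).trans hx.isSelfAdjoint.star_eq)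
  obtain ⟨p, hp, hpos, hneg, hzero⟩ := CStarAlgebra.exists_mul_self_mul_eq_neg hsa
  refine hzero (hf ?_)
  rw [map_zero]
  refine le_antisymm ?_ (map_nonneg f hpos)
  rw [← neg_nonneg, ← map_neg, ← hneg, map_mul, map_mul]
  have h := star_left_conjugate_nonneg hx (f p)
  rwa [← map_star, hp.star_eq] at h

namespace CStarMatrix

variable {n E : Type*} [Fintype n]

theorem diag_star_mul_self [CStarAlgebra E] (N : CStarMatrix n n E) (k : n) :
    (star N * N) k k = ∑ i, star (N i k) * N i k := by
  simp [mul_apply, star_apply]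

variable [DecidableEq n] [CStarAlgebra E] [PartialOrder E] [StarOrderedRing E]

theorem diag_nonneg {M : CStarMatrix n n E} (hM : 0 ≤ M) (k : n) : 0 ≤ M k k := by
  obtain ⟨N, rfl⟩ := CStarAlgebra.exists_eq_star_mul_self_of_nonneg hM
  rw [diag_star_mul_self]
  exact Finset.sum_nonneg fun i _ => star_mul_self_nonneg _

/-- Each diagonal entry of `N* N` is the sum of the squares `star (N i k) * N i k` down a column, so
its vanishing kills the whole column of `N`. -/
theorem eq_zero_of_diag_eq_zero {M : CStarMatrix n n E} (hM : 0 ≤ M) (h : ∀ k, M k k = 0) :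
    M = 0 := by
  obtain ⟨N, rfl⟩ := CStarAlgebra.exists_eq_star_mul_self_of_nonneg hM
  have hN : N = 0 := by
    ext i k
    have h1 := h k
    rw [diag_star_mul_self,
      Finset.sum_eq_zero_iff_of_nonneg fun i _ => star_mul_self_nonneg (N i k)] at h1
    exact CStarRing.star_mul_self_eq_zero_iff _ |>.1 (h1 i (Finset.mem_univ i))
  rw [hN, mul_zero]

/-- A self-adjoint matrix over a C⋆-algebra is positive if its quadratic form is. -/
theorem nonneg_of_forall_sum_nonneg {M : CStarMatrix n n E} (hM : IsSelfAdjoint M)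
    (h : ∀ v : n → E, 0 ≤ ∑ i, ∑ j, star (v i) * M i j * v j) : 0 ≤ M := by
  obtain ⟨p, hp, hpos, hneg, hzero⟩ := CStarAlgebra.exists_mul_self_mul_eq_neg hM
  refine hzero (eq_zero_of_diag_eq_zero hpos fun k => le_antisymm ?_ (diag_nonneg hpos k))
  -- This is the quadratic form of `M` at the `k`-th column of `p`.
  have h1 : (p * M * p) k k = ∑ i, ∑ j, star (p i k) * M i j * p j k := by
    simp only [mul_apply, Finset.sum_mul]
    rw [Finset.sum_comm]
    refine Finset.sum_congr rfl fun i _ => Finset.sum_congr rfl fun j _ => ?_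
    rw [star_apply_of_isSelfAdjoint hp]
  rw [hneg, neg_apply] at h1
  exact neg_nonneg.1 (h1 ▸ h fun i => p i k)

end CStarMatrix

/-! ### The weak limit map from the ultrapower to the double dual. -/

section WeakLimit

variable {A : Type*} [CStarAlgebra A] [PartialOrder A] [StarOrderedRing A] {ι : Type*}

theorem norm_universalRep_le (a : A) : ‖universalRep A a‖ ≤ ‖a‖ :=
  NonUnitalStarAlgHom.norm_apply_le (universalRep A) a

theorem DoubleDual.ext_inner {S T : DoubleDual A}
    (h : ∀ x y, ⟪(S : UniversalHilbert A →L[ℂ] UniversalHilbert A) x, y⟫_ℂ =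
      ⟪(T : UniversalHilbert A →L[ℂ] UniversalHilbert A) x, y⟫_ℂ) : S = T :=
  Subtype.ext <| ContinuousLinearMap.ext fun x => ext_inner_right ℂ (h x)

/-- Every element of the ultrapower determines an element of the double dual, the weak operator
limit of the images of its representatives. -/
theorem Ultrapower.exists_weakLimit (ω : Ultrafilter ι) (X : Ultrapower A ω) :
    ∃ S : DoubleDual A, ∀ a, Ultrapower.mk A ω a = X → ∀ x y,
      Tendsto (fun i => ⟪universalRep A (a i) x, y⟫_ℂ) ω
        (𝓝 ⟪(S : UniversalHilbert A →L[ℂ] UniversalHilbert A) x, y⟫_ℂ) := by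
  obtain ⟨a, rfl⟩ := Ultrapower.mk_surjective X
  obtain ⟨S, hS⟩ := exists_weakLimit_ultrafilter ω (T := fun i => universalRep A (a i))
    (C := ‖a‖) fun i => (norm_universalRep_le _).trans (Ultrapower.bdd a i)
  have hmem : S ∈ (envelopingVonNeumannAlgebra A).toStarSubalgebra := by
    change S ∈ StarSubalgebra.centralizer ℂ
      (StarSubalgebra.centralizer ℂ (Set.range (universalRep A)) :
        Set (UniversalHilbert A →L[ℂ] UniversalHilbert A))
    rw [StarSubalgebra.mem_centralizer_iff]
    have key (T : UniversalHilbert A →L[ℂ] UniversalHilbert A)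
        (hT : T ∈ StarSubalgebra.centralizer ℂ (Set.range (universalRep A))) : T * S = S * T := by
      refine ContinuousLinearMap.ext fun x => ext_inner_right ℂ fun y => ?_
      refine tendsto_nhds_unique (f := fun i => ⟪universalRep A (a i) (T x), y⟫_ℂ) ?_ (hS (T x) y)
      -- Moving `T` to the other side as its adjoint leaves a matrix coefficient of `S` alone, to
      -- which weak convergence applies.
      rw [mul_apply_eq_comp, ← ContinuousLinearMap.adjoint_inner_right]
      refine (hS x _).congr fun i => ?_
      rw [ContinuousLinearMap.adjoint_inner_right, ← mul_apply_eq_comp,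
        ← mul_apply_eq_comp,
        ((StarSubalgebra.mem_centralizer_iff ℂ).1 hT _ ⟨a i, rfl⟩).1]
    exact fun T hT => ⟨key T hT, key _ (star_mem hT)⟩
  refine ⟨⟨S, hmem⟩, fun b hb x y => ?_⟩
  -- Two representatives differ by a family whose norms tend to zero along `ω`, so the same `S`
  -- serves every representative.
  have hz : Tendsto (fun i => ⟪universalRep A (b i - a i) x, y⟫_ℂ) ω (𝓝 0) := by
    refine squeeze_zero_norm (a := fun i => ‖b i - a i‖ * (‖x‖ * ‖y‖)) (fun i => ?_)
      (by simpa using (Ultrapower.mk_eq_mk.1 hb).mul_const (‖x‖ * ‖y‖))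
    rw [← mul_assoc]
    exact (norm_inner_le_norm _ _).trans <| mul_le_mul_of_nonneg_right
      ((ContinuousLinearMap.le_opNorm _ _).trans <|
        mul_le_mul_of_nonneg_right (norm_universalRep_le _) (norm_nonneg _)) (norm_nonneg _)
  simpa [inner_sub_left] using hz.add (hS x y)

namespace Ultrapower

variable (A) in
/-- The weak operator limit of an element of the ultrapower, in the double dual. -/
noncomputable def weakLimit (ω : Ultrafilter ι) (X : Ultrapower A ω) : DoubleDual A :=
  (exists_weakLimit ω X).choose

variable {ω : Ultrafilter ι}

theorem tendsto_weakLimit (a : lp (fun _ : ι => A) ∞) (x y : UniversalHilbert A) :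
    Tendsto (fun i => ⟪universalRep A (a i) x, y⟫_ℂ) ω
      (𝓝 ⟪(weakLimit A ω (mk A ω a) : UniversalHilbert A →L[ℂ] UniversalHilbert A) x, y⟫_ℂ) :=
  (exists_weakLimit ω (mk A ω a)).choose_spec a rfl x y

/-- Weak operator limits are unique; identities for the chosen limit thus reduce to limits of
scalars on any representative. -/
theorem weakLimit_eq {a : lp (fun _ : ι => A) ∞} {S : DoubleDual A}
    (h : ∀ x y, Tendsto (fun i => ⟪universalRep A (a i) x, y⟫_ℂ) ω
      (𝓝 ⟪(S : UniversalHilbert A →L[ℂ] UniversalHilbert A) x, y⟫_ℂ)) :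
    weakLimit A ω (mk A ω a) = S :=
  DoubleDual.ext_inner fun x y => tendsto_nhds_unique (tendsto_weakLimit a x y) (h x y)

theorem weakLimit_diagonal (a : A) :
    weakLimit A ω (diagonal A ω a) = DoubleDual.inclusion A a :=
  weakLimit_eq (a := const ι a) fun _ _ => tendsto_const_nhds

variable (A ω) in
/-- The weak operator limit as a linear map. -/
noncomputable def weakLimitₗ : Ultrapower A ω →ₗ[ℂ] DoubleDual A where
  toFun := weakLimit A ω
  map_add' X Y := by
    obtain ⟨a, rfl⟩ := mk_surjective X
    obtain ⟨b, rfl⟩ := mk_surjective Y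
    rw [← map_add]
    refine weakLimit_eq fun x y => ?_
    simpa [inner_add_left] using (tendsto_weakLimit (ω := ω) a x y).add (tendsto_weakLimit b x y)
  map_smul' c X := by
    obtain ⟨a, rfl⟩ := mk_surjective X
    rw [← map_smul]
    refine weakLimit_eq fun x y => ?_
    simpa [mul_comm] using
      (tendsto_weakLimit (ω := ω) a x y).const_mul (starRingEnd ℂ c)

theorem weakLimit_star (X : Ultrapower A ω) : weakLimit A ω (star X) = star (weakLimit A ω X) := by
  obtain ⟨a, rfl⟩ := mk_surjective X
  rw [← mk_star]
  refine weakLimit_eq fun x y => ?_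
  rw [StarMemClass.coe_star, ContinuousLinearMap.star_eq_adjoint,
    ContinuousLinearMap.adjoint_inner_left, ← inner_conj_symm]
  refine ((Complex.continuous_conj.tendsto _).comp (tendsto_weakLimit a y x)).congr fun i => ?_
  rw [Function.comp_apply, inner_conj_symm, lp.star_apply, map_star,
    ContinuousLinearMap.star_eq_adjoint, ContinuousLinearMap.adjoint_inner_left]

/-- The quadratic form of the weak limit of a positive matrix is positive. -/
theorem sum_inner_weakLimit_nonneg {n : Type*} [Fintype n]
    (N : CStarMatrix n n (Ultrapower A ω)) (ξ : n → UniversalHilbert A) :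
    0 ≤ ∑ i, ∑ j, ⟪(weakLimit A ω ((star N * N) i j) :
      UniversalHilbert A →L[ℂ] UniversalHilbert A) (ξ j), ξ i⟫_ℂ := by
  choose c hc using fun i j => mk_surjective (N i j)
  have hentry (i j : n) : (star N * N) i j = mk A ω (∑ k, star (c k i) * c k j) := by
    simp [CStarMatrix.mul_apply, CStarMatrix.star_apply, mk_mul, mk_star, hc]
  simp only [hentry]
  refine ge_of_tendsto (x := (ω : Filter ι)) (tendsto_finsetSum _ fun i _ =>
    tendsto_finsetSum _ fun j _ => tendsto_weakLimit _ (ξ j) (ξ i)) (Eventually.of_forall fun l => ?_)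
  -- At a fixed index `l`, the form is the sum over the rows `k` of `‖∑ⱼ π_u(c k j l) ξⱼ‖²`.
  have hsum : ∑ i, ∑ j, ⟪universalRep A ((∑ k, star (c k i) * c k j :
      lp (fun _ : ι => A) ∞) l) (ξ j), ξ i⟫_ℂ =
      ∑ k, ⟪∑ j, universalRep A (c k j l) (ξ j), ∑ j, universalRep A (c k j l) (ξ j)⟫_ℂ := by
    have h1 (i j : n) : ⟪universalRep A ((∑ k, star (c k i) * c k j :
        lp (fun _ : ι => A) ∞) l) (ξ j), ξ i⟫_ℂ =
        ∑ k, ⟪universalRep A (c k j l) (ξ j), universalRep A (c k i l) (ξ i)⟫_ℂ := by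
      rw [lp.coeFn_sum, Finset.sum_apply, map_sum, sum_apply, sum_inner]
      refine Finset.sum_congr rfl fun k _ => ?_
      rw [lp.infty_coeFn_mul, Pi.mul_apply, lp.star_apply, map_mul, map_star,
        mul_apply_eq_comp, ContinuousLinearMap.star_eq_adjoint,
        ContinuousLinearMap.adjoint_inner_left]
    simp only [h1, sum_inner, inner_sum]
    exact (Finset.sum_congr rfl fun i _ => Finset.sum_comm).trans Finset.sum_comm
  rw [hsum]
  exact Finset.sum_nonneg fun k _ => inner_self_nonneg_complex _

theorem weakLimit_map_nonneg {n : Type*} [Fintype n] [DecidableEq n]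
    {M : CStarMatrix n n (Ultrapower A ω)}
    (hM : 0 ≤ M) : 0 ≤ M.map (weakLimitₗ A ω) := by
  refine CStarMatrix.nonneg_of_forall_sum_nonneg ?_ fun v => ?_
  · refine CStarMatrix.ext fun i j => ?_
    rw [CStarMatrix.star_apply, CStarMatrix.map_apply, CStarMatrix.map_apply]
    exact (weakLimit_star _).symm.trans
      (congrArg _ (CStarMatrix.star_apply_of_isSelfAdjoint hM.isSelfAdjoint))
  obtain ⟨N, rfl⟩ := CStarAlgebra.exists_eq_star_mul_self_of_nonneg hM
  refine CStarAlgebra.nonneg_of_map_nonneg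
    (envelopingVonNeumannAlgebra A).toStarSubalgebra.subtype Subtype.val_injective ?_
  refine ContinuousLinearMap.nonneg_of_forall_inner_nonneg fun x => ?_
  -- The form of `∑ star (v i) * S i j * v j` at `x` is the form of the matrix `S` of weak limits at
  -- the vectors `v i x`.
  have h := sum_inner_weakLimit_nonneg N fun i =>
    (v i : UniversalHilbert A →L[ℂ] UniversalHilbert A) x
  rw [← inner_sum_star_mul_mul_apply] at h
  simp only [map_sum, map_mul, map_star]
  exact h

variable (A ω) in
/-- The weak operator limit as a completely positive map. -/
noncomputable def weakLimitCP : Ultrapower A ω →CP DoubleDual A where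
  toLinearMap := weakLimitₗ A ω
  map_cstarMatrix_nonneg' _ _ hM := weakLimit_map_nonneg hM

theorem weakLimitCP_diagonal (a : A) :
    weakLimitCP A ω (diagonal A ω a) = DoubleDual.inclusion A a :=
  weakLimit_diagonal a

theorem isUCP_weakLimitCP : IsUCP (weakLimitCP A ω) := by
  have h := weakLimitCP_diagonal (ω := ω) (1 : A)
  rw [map_one (diagonal A ω), map_one (DoubleDual.inclusion A)] at h
  exact h

end Ultrapower

end WeakLimit

/-! ### Composition with the given u.c.p. map, and the proposition. -/

/-- The composition of completely positive maps. -/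
def CompletelyPositiveMap.comp {A B C : Type*} [NonUnitalCStarAlgebra A] [PartialOrder A]
    [StarOrderedRing A] [NonUnitalCStarAlgebra B] [PartialOrder B] [StarOrderedRing B]
    [NonUnitalCStarAlgebra C] [PartialOrder C] [StarOrderedRing C]
    (ψ : B →CP C) (φ : A →CP B) : A →CP C where
  toLinearMap := ψ.toLinearMap ∘ₗ φ.toLinearMap
  map_cstarMatrix_nonneg' k _ hM :=
    ψ.map_cstarMatrix_nonneg' k _ (φ.map_cstarMatrix_nonneg' k _ hM)

theorem mainTheorem6 {A : Type*} [CStarAlgebra A] [PartialOrder A] [StarOrderedRing A]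
    {ι : Type*} (ω : Ultrafilter ι) (hω : ∀ i : ι, ω ≠ pure i) :
    (∀ {B : Type*} [CStarAlgebra B] [PartialOrder B] [StarOrderedRing B]
        (j : A →⋆ₙₐ[ℂ] B), Function.Injective j →
        (∃ Φ : B →CP Ultrapower A ω, IsUCP Φ ∧ ∀ a : A, Φ (j a) = Ultrapower.diagonal A ω a) →
        RelativelyWeaklyInjective j) ∧
      RelativelyWeaklyInjective (Ultrapower.diagonal A ω).toNonUnitalStarAlgHom := by
  refine ⟨?_, Ultrapower.weakLimitCP A ω, Ultrapower.isUCP_weakLimitCP,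
    Ultrapower.weakLimitCP_diagonal⟩
  rintro B _ _ _ j - ⟨Φ, hΦ, hj⟩
  refine ⟨(Ultrapower.weakLimitCP A ω).comp Φ, ?_, fun a => ?_⟩
  · exact (congrArg (Ultrapower.weakLimitCP A ω) hΦ).trans Ultrapower.isUCP_weakLimitCP
  · exact (congrArg (Ultrapower.weakLimitCP A ω) (hj a)).trans (Ultrapower.weakLimitCP_diagonal a)
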